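/- \textbf{Setting.} Let $I=[0,1]$ with Lebesgue measure $m$, and let $1\le p<\infty$. For $f\in L^1(I)$ and $r>0$ put \[ \operatorname{Osc}(f,r,x)=\operatorname{ess\,sup}\{|f(y_1)-f(y_2)| : y_1,y_2\in(x-r,x+r)\cap I\},\qquad \operatorname{Osc}_1(f,r)=\int_I \operatorname{Osc}(f,r,x)\,dm(x), \] \[ \operatorname{var}_{1,1/p}(f)=\sup_{0<r\le 1}\frac{\operatorname{Osc}_1(f,r)}{r^{1/p}},\qquad \|f\|_{1,1/p}=\operatorname{var}_{1,1/p}(f)+\|f\|_1, \] and let $BV_{1,1/p}(I)=\{f\in L^1(I):\operatorname{var}_{1,1/p}(f)<\infty\}$. Let $s>1$ and $\varepsilon>0$. A map $\tau:I\to I$ belongs to $\mathcal T([0,1];s,\varepsilon)$ if there is a finite partition $0=a_0<a_1<\dots<a_N=1$ such that on each $(a_{i-1},a_i)$ the map $\tau$ is monotone and $C^1$, extends continuously to $[a_{i-1},a_i]$, satisfies $|\tau'|\ge s$, and has an $\varepsilon$-Hölder continuous derivative. Its Frobenius--Perron operator $P_\tau:L^1(I)\to L^1(I)$ is determined by $\int_A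 P_\tau f\,dm=\int_{\tau^{-1}(A)}f\,dm$ for all Borel sets $A\subset I$. Let $\alpha_0=\alpha_0(\tau,p)$ be the Lasota--Yorke constant of $P_\tau$: the infimum of all $a\in(0,1)$ for which there is $C_0>0$ such that \[ \operatorname{var}_{1,1/p}(P_\tau f)\le a\,\|f\|_{1,1/p}+C_0\|f\|_1\qquad\text{for all } f\in BV_{1,1/p}(I) \] ($\alpha_0=\infty$ if there is no such $a$). Let $q:\mathbb R\to[0,\infty)$ be $C^1$ with $\operatorname{supp} q\subset[-1,1]$ and $\int_{\mathbb R}q=1$. For $0<\delta<1/4$ let \[ (Q_\delta f)(x)=\int_I q^{\mathrm{per}}_\delta(x,y)f(y)\,dy,\qquad q^{\mathrm{per}}_\delta(x,y)=\sum_{n\in\mathbb Z}\delta^{-1}q\!\left(\frac{x-y+n}{\delta}\right),\qquad P_\delta=Q_\delta P_\tau . \] \textbf{Theorem (uniform Lasota--Yorke inequality).} Let $\tau\in\mathcal T([0,1];s,\varepsilon)$ and assume the joint expansion--kernel condition \[ \alpha_0<\frac1{\widetilde C_1},\qquad \widetilde C_1=(1+2^{1+1/p})\,2^{1/p}\max\{1,4\|q'\|_\infty\}.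 \] Then there are constants $\alpha\in(0,1)$ and $C>0$, independent of $\delta$, such that for every $\delta\in(0,1/4)$ and every $f\in BV_{1,1/p}(I)$ one has $P_\delta f\in BV_{1,1/p}(I)$ and \[ \|P_\delta f\|_{1,1/p}\le\alpha\|f\|_{1,1/p}+C\|f\|_1 . \] -/

import Mathlib

open MeasureTheory Set
open scoped ENNReal unitInterval

noncomputable section

/-! ## The space of functions of generalized bounded variation on `I = [0,1]`

Functions on `I` are real functions on the type `unitInterval`, with its Lebesgue measure `volume`.
All notions below depend only on the almost-everywhere class of the function. -/

/-- `Osc(f, r, x)`, the (essential) supremum of `|f y₁ - f y₂|` over `y₁, y₂ ∈ (x - r, x + r) ∩ I`.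
It is taken modulo null sets, as is required for elements of `L¹(I)`. Note that
`Metric.ball x r` in the subtype `I` is `(x - r, x + r) ∩ I`. -/
def osc (f : I → ℝ) (r : ℝ) (x : I) : ℝ≥0∞ :=
  essSup (fun y : I × I => ‖f y.1 - f y.2‖ₑ)
    (((volume : Measure I).restrict (Metric.ball x r)).prod
      ((volume : Measure I).restrict (Metric.ball x r)))

/-- `Osc₁(f, r) = ∫_I Osc(f, r, x) dx`. -/
def oscOne (f : I → ℝ) (r : ℝ) : ℝ≥0∞ :=
  ∫⁻ x : I, osc f r x

/-- `var_{1,1/p}(f) = sup_{0 < r ≤ 1} Osc₁(f, r) / r^{1/p}`. -/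
def bvVar (p : ℝ) (f : I → ℝ) : ℝ≥0∞ :=
  ⨆ r ∈ Ioc (0 : ℝ) 1, oscOne f r / ENNReal.ofReal (r ^ (1 / p))

/-- The `L¹(I)` norm. -/
def lOneNorm (f : I → ℝ) : ℝ≥0∞ :=
  eLpNorm f 1 (volume : Measure I)

/-- `‖f‖_{1,1/p} = var_{1,1/p}(f) + ‖f‖₁`. -/
def bvNorm (p : ℝ) (f : I → ℝ) : ℝ≥0∞ :=
  bvVar p f + lOneNorm f

/-- `f ∈ BV_{1,1/p}(I)`: `f ∈ L¹(I)` and `var_{1,1/p}(f) < ∞`. -/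
def MemBV (p : ℝ) (f : I → ℝ) : Prop :=
  Integrable f (volume : Measure I) ∧ bvVar p f < ∞

/-! ## Piecewise expanding maps and the Frobenius–Perron operator -/

/-- A self-map of `I`, read as a real function of a real variable. It is only ever differentiated
at points of the open interval `(0,1)`, where the extension outside `I` plays no role. -/
def realExtend (τ : I → I) : ℝ → ℝ :=
  IccExtend (zero_le_one' ℝ) (fun x : I => (τ x : ℝ))

/-- The class `T([0,1]; s, ε)`: there is a partition `0 = a₀ < a₁ < ⋯ < a_N = 1` such that on each
open interval of the partition `τ` is monotone and `C¹`, extends continuously to the closed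
interval, satisfies `|τ'| ≥ s`, and has an `ε`-Hölder derivative. -/
structure IsPiecewiseExpanding (s ε : ℝ) (τ : I → I) : Prop where
  one_lt : 1 < s
  eps_pos : 0 < ε
  exists_partition : ∃ (N : ℕ) (a : Fin (N + 1) → ℝ),
    a 0 = 0 ∧ a (Fin.last N) = 1 ∧ StrictMono a ∧
    ∀ i : Fin N,
      (MonotoneOn (realExtend τ) (Ioo (a i.castSucc) (a i.succ)) ∨
        AntitoneOn (realExtend τ) (Ioo (a i.castSucc) (a i.succ))) ∧
      ContDiffOn ℝ 1 (realExtend τ) (Ioo (a i.castSucc) (a i.succ)) ∧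
      (∃ g : ℝ → ℝ, ContinuousOn g (Icc (a i.castSucc) (a i.succ)) ∧
        EqOn g (realExtend τ) (Ioo (a i.castSucc) (a i.succ))) ∧
      (∀ x ∈ Ioo (a i.castSucc) (a i.succ), s ≤ |deriv (realExtend τ) x|) ∧
      (∃ H : ℝ, ∀ x ∈ Ioo (a i.castSucc) (a i.succ), ∀ y ∈ Ioo (a i.castSucc) (a i.succ),
        |deriv (realExtend τ) x - deriv (realExtend τ) y| ≤ H * |x - y| ^ ε)

/-- The Frobenius–Perron operator `P_τ`: `P_τ f` is the density, with respect to Lebesgue measure,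
of the image under `τ` of the signed measure with density `f`; that is,
`∫_A P_τ f = ∫_{τ⁻¹ A} f` for every Borel set `A`. -/
def frobeniusPerron (τ : I → I) (f : I → ℝ) : I → ℝ :=
  SignedMeasure.rnDeriv (((volume : Measure I).withDensityᵥ f).map τ) (volume : Measure I)

/-- `(α₀, C₀)` is an admissible pair of Lasota–Yorke constants for `P_τ` on `BV_{1,1/p}(I)`:
`0 < α₀ < 1`, `C₀ > 0` and `var_{1,1/p}(P_τ f) ≤ α₀ ‖f‖_{1,1/p} + C₀ ‖f‖₁`
for all `f ∈ BV_{1,1/p}(I)`. -/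
def IsLasotaYorkePair (τ : I → I) (p α₀ C₀ : ℝ) : Prop :=
  0 < α₀ ∧ α₀ < 1 ∧ 0 < C₀ ∧
    ∀ f : I → ℝ, MemBV p f →
      bvVar p (frobeniusPerron τ f) ≤
        ENNReal.ofReal α₀ * bvNorm p f + ENNReal.ofReal C₀ * lOneNorm f

/-- The Lasota–Yorke constant `α₀` of `P_τ` on `BV_{1,1/p}(I)`: the infimum of the first components
of all admissible pairs. It is `∞` if there is no admissible pair. -/
def lasotaYorkeConstant (τ : I → I) (p : ℝ) : ℝ≥0∞ :=
  sInf {a : ℝ≥0∞ | ∃ α₀ C₀ : ℝ, IsLasotaYorkePair τ p α₀ C₀ ∧ a = ENNReal.ofReal α₀}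

/-! ## The noise -/

/-- A noise kernel: a nonnegative `C¹` probability density on `ℝ` supported in `[-1,1]`.
Its derivative is automatically bounded. -/
structure IsNoiseKernel (q : ℝ → ℝ) : Prop where
  contDiff : ContDiff ℝ 1 q
  nonneg : ∀ z, 0 ≤ q z
  tsupport_subset : tsupport q ⊆ Icc (-1) 1
  integral_eq_one : ∫ z, q z = 1

/-- `‖q'‖_∞`. -/
def derivSupNorm (q : ℝ → ℝ) : ℝ :=
  ⨆ z : ℝ, |deriv q z|

/-- The periodized kernel `∑_{n ∈ ℤ} δ⁻¹ q((x - y + n) / δ)`. -/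
def periodizedKernel (q : ℝ → ℝ) (δ : ℝ) (x y : I) : ℝ :=
  ∑' n : ℤ, δ⁻¹ * q (((x : ℝ) - (y : ℝ) + (n : ℝ)) / δ)

/-- The smoothing operator `(Q_δ f)(x) = ∫_I q_δ^{per}(x, y) f(y) dy`. -/
def smoothing (q : ℝ → ℝ) (δ : ℝ) (f : I → ℝ) (x : I) : ℝ :=
  ∫ y : I, periodizedKernel q δ x y * f y

/-- The perturbed Frobenius–Perron operator `P_δ = Q_δ P_τ`. -/
def perturbedFP (τ : I → I) (q : ℝ → ℝ) (δ : ℝ) (f : I → ℝ) : I → ℝ :=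
  smoothing q δ (frobeniusPerron τ f)

/-- The constant `C̃₁ = (1 + 2^{1+1/p}) 2^{1/p} max {1, 4 ‖q'‖_∞}`. -/
def kernelConstant (q : ℝ → ℝ) (p : ℝ) : ℝ :=
  (1 + (2 : ℝ) ^ (1 + 1 / p)) * (2 : ℝ) ^ (1 / p) * max 1 (4 * derivSupNorm q)

end

/-! `Q_δ` is convolution on the circle with a nonnegative kernel of mass at most one. On the circle
translations are isometries, so `Osc(K * G, r, u) ≤ ∫ |K a| Osc(G, r, u - a) da`, and `Osc₁` does
not grow (`lintegral_essOsc_convolution_le`). Passing from the circle back to `I` is free, because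
the projection is 1-Lipschitz and measure preserving. Passing from `I` to the circle joins the
endpoints. This matters only on a boundary layer of measure at most `2r`, where the oscillation is
at most `Osc₁(g, 1) ≤ var g` (`lintegral_essOsc_circle_le`). As `r ≤ r^{1/p}`, this gives `var (Q_δ
g) ≤ 3 var g` uniformly in `δ` (`IsNoiseKernel.smoothing_bounds`). Since `3 ≤ C̃₁`, a Lasota–Yorke
pair of `P_τ` with first entry below `1 / C̃₁` survives the factor 3; both `P_τ` and `Q_δ` contract
`L¹`. -/

/-- The essential oscillation of `f` over the ball of radius `r` around `x`. -/
noncomputable def essOsc {X : Type*} [PseudoMetricSpace X] [MeasureSpace X] (f : X → ℝ) (r : ℝ)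
    (x : X) : ℝ≥0∞ :=
  essSup (fun y : X × X => ‖f y.1 - f y.2‖ₑ)
    (((volume : Measure X).restrict (Metric.ball x r)).prod
      ((volume : Measure X).restrict (Metric.ball x r)))

/-! ### Essential oscillation on a metric measure space. -/

section EssOsc

variable {X : Type*} [PseudoMetricSpace X] [MeasureSpace X] [OpensMeasurableSpace X]
  [SFinite (volume : Measure X)]

/-- Moves the ball from the measure into the predicate, so that bounds can be pulled back along
measure-preserving maps and combined by Fubini. -/
theorem essOsc_le_iff {f : X → ℝ} {r : ℝ} {x : X} {M : ℝ≥0∞} :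
    essOsc f r x ≤ M ↔ ∀ᵐ y : X × X, y.1 ∈ Metric.ball x r → y.2 ∈ Metric.ball x r →
      ‖f y.1 - f y.2‖ₑ ≤ M := by
  have hm : MeasurableSet (Metric.ball x r ×ˢ Metric.ball x r) :=
    measurableSet_ball.prod measurableSet_ball
  have hae : (∀ᵐ y ∂(((volume : Measure X).restrict (Metric.ball x r)).prod
      ((volume : Measure X).restrict (Metric.ball x r))), ‖f y.1 - f y.2‖ₑ ≤ M) ↔
      ∀ᵐ y : X × X, y.1 ∈ Metric.ball x r → y.2 ∈ Metric.ball x r →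
        ‖f y.1 - f y.2‖ₑ ≤ M := by
    rw [Measure.prod_restrict, ae_restrict_iff' hm, Measure.volume_eq_prod]
    simp only [mem_prod, and_imp]
  rw [← hae]
  constructor
  · intro h
    filter_upwards [ENNReal.ae_le_essSup (fun y : X × X => ‖f y.1 - f y.2‖ₑ)] with y hy
    exact hy.trans h
  · exact fun h => essSup_le_of_ae_le M h

theorem ae_le_essOsc (f : X → ℝ) (r : ℝ) (x : X) :
    ∀ᵐ y : X × X, y.1 ∈ Metric.ball x r → y.2 ∈ Metric.ball x r →
      ‖f y.1 - f y.2‖ₑ ≤ essOsc f r x :=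
  essOsc_le_iff.1 le_rfl

theorem essOsc_congr_ae {f g : X → ℝ} (h : f =ᵐ[volume] g) (r : ℝ) : essOsc f r = essOsc g r := by
  have h1 : ∀ᵐ y : X × X, f y.1 = g y.1 := Measure.quasiMeasurePreserving_fst.ae h
  have h2 : ∀ᵐ y : X × X, f y.2 = g y.2 := Measure.quasiMeasurePreserving_snd.ae h
  ext x
  refine eq_of_forall_ge_iff fun M => ?_
  simp only [essOsc_le_iff]
  refine Filter.eventually_congr ?_
  filter_upwards [h1, h2] with y hy1 hy2
  rw [hy1, hy2]

theorem measurable_essOsc [SecondCountableTopology X] {f : X → ℝ} (hf : Measurable f) (r : ℝ) :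
    Measurable (essOsc f r) := by
  refine measurable_of_Iic fun M => ?_
  -- A sublevel set of the oscillation consists of the centres whose slice of this bad set is null.
  have hS : MeasurableSet {z : X × X × X | z.2.1 ∈ Metric.ball z.1 r ∧ z.2.2 ∈ Metric.ball z.1 r ∧
      ¬ ‖f z.2.1 - f z.2.2‖ₑ ≤ M} := by
    have h1 : MeasurableSet {z : X × X × X | dist z.2.1 z.1 < r} :=
      (isOpen_lt (by fun_prop) (by fun_prop)).measurableSet
    have h2 : MeasurableSet {z : X × X × X | dist z.2.2 z.1 < r} :=
      (isOpen_lt (by fun_prop) (by fun_prop)).measurableSet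
    refine h1.inter (h2.inter ?_)
    have hf' : Measurable fun z : X × X × X => ‖f z.2.1 - f z.2.2‖ₑ := by fun_prop
    exact (measurableSet_le hf' measurable_const).compl
  have hmeas := measurable_measure_prodMk_left (ν := (volume : Measure (X × X))) hS
  convert hmeas (measurableSet_singleton 0) using 1
  ext x
  rw [mem_preimage, mem_Iic, essOsc_le_iff, ae_iff]
  simp only [Classical.not_imp, mem_preimage, mem_singleton_iff]
  rfl

/-- The oscillation of a pull-back under a nonexpansive measure-preserving map. -/
theorem essOsc_comp_le {Y : Type*} [PseudoMetricSpace Y] [MeasureSpace Y] [OpensMeasurableSpace Y]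
    [SFinite (volume : Measure Y)] {φ : Y → X} (hφ : MeasurePreserving φ)
    (hd : ∀ a b, dist (φ a) (φ b) ≤ dist a b) (f : X → ℝ) (r : ℝ) (y : Y) :
    essOsc (f ∘ φ) r y ≤ essOsc f r (φ y) := by
  rw [essOsc_le_iff]
  have h := (hφ.prod hφ).quasiMeasurePreserving.ae (ae_le_essOsc f r (φ y))
  filter_upwards [h] with z hz h1 h2
  exact hz ((hd _ _).trans_lt h1) ((hd _ _).trans_lt h2)

/-- The oscillation over the whole space bounds almost all differences. -/
theorem enorm_sub_le_lintegral_essOsc [IsProbabilityMeasure (volume : Measure X)]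
    {r : ℝ} (hball : ∀ x : X, (volume : Measure X) (Metric.ball x r)ᶜ = 0) (f : X → ℝ) :
    ∀ᵐ y : X × X, ‖f y.1 - f y.2‖ₑ ≤ ∫⁻ x, essOsc f r x := by
  -- Every ball of radius `r` is conull, so the oscillation does not depend on its centre and equals
  -- its mean.
  have hconst : ∀ x x' : X, essOsc f r x ≤ essOsc f r x' := by
    intro x x'
    rw [essOsc_le_iff]
    have hb : ∀ᵐ y : X, y ∈ Metric.ball x' r := by rw [ae_iff]; exact hball x'
    have h1 : ∀ᵐ y : X × X, y.1 ∈ Metric.ball x' r := Measure.quasiMeasurePreserving_fst.ae hb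
    have h2 : ∀ᵐ y : X × X, y.2 ∈ Metric.ball x' r := Measure.quasiMeasurePreserving_snd.ae hb
    filter_upwards [h1, h2, ae_le_essOsc f r x'] with y hy1 hy2 hy _ _
    exact hy hy1 hy2
  have hne : Nonempty X := (volume : Measure X).nonempty_of_neZero
  obtain ⟨x⟩ := hne
  have hD : ∫⁻ x', essOsc f r x' = essOsc f r x := by
    have : essOsc f r = fun _ => essOsc f r x :=
      funext fun x' => le_antisymm (hconst _ _) (hconst _ _)
    rw [this]
    simp
  rw [hD]
  have hb : ∀ᵐ y : X, y ∈ Metric.ball x r := by rw [ae_iff]; exact hball x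
  have h1 : ∀ᵐ y : X × X, y.1 ∈ Metric.ball x r := Measure.quasiMeasurePreserving_fst.ae hb
  have h2 : ∀ᵐ y : X × X, y.2 ∈ Metric.ball x r := Measure.quasiMeasurePreserving_snd.ae hb
  filter_upwards [h1, h2, ae_le_essOsc f r x] with y hy1 hy2 hy
  exact hy hy1 hy2

end EssOsc

/-! ### Convolution does not increase the mean oscillation. -/

section Convolution

variable {A : Type*} [SeminormedAddCommGroup A] [MeasureSpace A] [BorelSpace A]
  [SecondCountableTopology A] [SFinite (volume : Measure A)]

theorem measurable_convolution {K G : A → ℝ} (hK : Measurable K) (hG : Measurable G) :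
    Measurable fun u => ∫ a, K a * G (u - a) := by
  have : Measurable fun z : A × A => K z.2 * G (z.1 - z.2) := by fun_prop
  exact this.stronglyMeasurable.integral_prod_right.measurable

variable [(volume : Measure A).IsAddLeftInvariant]

theorem essOsc_convolution_le [(volume : Measure A).IsNegInvariant] {K G : A → ℝ} (hK : Measurable K) {c : ℝ} (hKc : ∀ a, ‖K a‖ ≤ c)
    (hG : Measurable G) (hGi : Integrable G) (r : ℝ) (u : A) :
    essOsc (fun v => ∫ a, K a * G (v - a)) r u ≤ ∫⁻ a, ‖K a‖ₑ * essOsc G r (u - a) := by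
  rw [essOsc_le_iff]
  have hint : ∀ v, Integrable fun a => K a * G (v - a) := fun v =>
    (hGi.comp_sub_left v).bdd_mul hK.aestronglyMeasurable (Filter.Eventually.of_forall hKc)
  have h1 : ∀ a : A, ∀ᵐ y : A × A, y.1 ∈ Metric.ball u r → y.2 ∈ Metric.ball u r →
      ‖G (y.1 - a) - G (y.2 - a)‖ₑ ≤ essOsc G r (u - a) := by
    intro a
    have hp := measurePreserving_sub_right (volume : Measure A) a
    filter_upwards [(hp.prod hp).quasiMeasurePreserving.ae (ae_le_essOsc G r (u - a))]
      with y hy hy1 hy2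
    refine hy ?_ ?_
    · simpa [Prod.map] using hy1
    · simpa [Prod.map] using hy2
  have hS : MeasurableSet {z : A × A × A | z.2.1 ∈ Metric.ball u r → z.2.2 ∈ Metric.ball u r →
      ‖G (z.2.1 - z.1) - G (z.2.2 - z.1)‖ₑ ≤ essOsc G r (u - z.1)} := by
    have hO := measurable_essOsc hG r
    have hE : MeasurableSet {z : A × A × A |
        ‖G (z.2.1 - z.1) - G (z.2.2 - z.1)‖ₑ ≤ essOsc G r (u - z.1)} :=
      measurableSet_le (by fun_prop) (by fun_prop)
    have hb1 : MeasurableSet {z : A × A × A | z.2.1 ∈ Metric.ball u r} :=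
      measurableSet_ball.preimage (by fun_prop)
    have hb2 : MeasurableSet {z : A × A × A | z.2.2 ∈ Metric.ball u r} :=
      measurableSet_ball.preimage (by fun_prop)
    exact hb1.imp (hb2.imp hE)
  -- The exceptional null set of pairs depends on `a`; Fubini exchanges the quantifiers, which is
  -- why `hS` is needed.
  have h2 : ∀ᵐ y : A × A, ∀ᵐ a : A, y.1 ∈ Metric.ball u r → y.2 ∈ Metric.ball u r →
      ‖G (y.1 - a) - G (y.2 - a)‖ₑ ≤ essOsc G r (u - a) :=
    (Measure.ae_ae_comm hS).1 (Filter.Eventually.of_forall h1)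
  filter_upwards [h2] with y hy hy1 hy2
  rw [← integral_sub (hint _) (hint _)]
  refine (enorm_integral_le_lintegral_enorm _).trans (lintegral_mono_ae ?_)
  filter_upwards [hy] with a ha
  rw [← mul_sub, enorm_mul]
  gcongr
  exact ha hy1 hy2

theorem lintegral_lintegral_mul_sub {k F : A → ℝ≥0∞} (hk : Measurable k) (hF : Measurable F) :
    ∫⁻ u, ∫⁻ a, k a * F (u - a) = (∫⁻ a, k a) * ∫⁻ u, F u := by
  rw [lintegral_lintegral_swap (by fun_prop)]
  have : ∀ a, ∫⁻ u, k a * F (u - a) = k a * ∫⁻ u, F u := fun a => by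
    rw [lintegral_const_mul _ (by fun_prop), lintegral_sub_right_eq_self]
  simp_rw [this]
  rw [lintegral_mul_const _ hk]

theorem lintegral_essOsc_convolution_le [(volume : Measure A).IsNegInvariant]
    {K G : A → ℝ} (hK : Measurable K) {c : ℝ}
    (hKc : ∀ a, ‖K a‖ ≤ c) (hG : Measurable G) (hGi : Integrable G) (r : ℝ) :
    ∫⁻ u, essOsc (fun v => ∫ a, K a * G (v - a)) r u ≤ (∫⁻ a, ‖K a‖ₑ) * ∫⁻ u, essOsc G r u := by
  rw [← lintegral_lintegral_mul_sub hK.enorm (measurable_essOsc hG r)]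
  exact lintegral_mono fun u => essOsc_convolution_le hK hKc hG hGi r u

theorem lintegral_enorm_convolution_le {K G : A → ℝ} (hK : Measurable K) (hG : Measurable G) :
    ∫⁻ u, ‖∫ a, K a * G (u - a)‖ₑ ≤ (∫⁻ a, ‖K a‖ₑ) * ∫⁻ u, ‖G u‖ₑ := by
  rw [← lintegral_lintegral_mul_sub hK.enorm hG.enorm]
  refine lintegral_mono fun u => (enorm_integral_le_lintegral_enorm _).trans ?_
  simp [enorm_mul]

end Convolution

/-! ### `L¹` contraction of the Frobenius–Perron operator. -/

section FrobeniusPerron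

/-- The Radon–Nikodym derivative of the push-forward of a signed measure with density `f` has
`L¹` norm at most that of `f`. -/
theorem lintegral_enorm_rnDeriv_map_withDensityᵥ_le {X Y : Type*} [MeasurableSpace X]
    [MeasurableSpace Y] {μ : Measure X} (ν : Measure Y) (τ : X → Y) {f : X → ℝ}
    (hf : Integrable f μ) :
    ∫⁻ y, ‖SignedMeasure.rnDeriv ((μ.withDensityᵥ f).map τ) ν y‖ₑ ∂ν ≤ ∫⁻ x, ‖f x‖ₑ ∂μ := by
  set s : SignedMeasure Y := (μ.withDensityᵥ f).map τ with hs
  -- On a Hahn set `B` the total variation is `|s B| + |s Bᶜ|`, and the two preimages under `τ` are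
  -- disjoint.
  obtain ⟨B, hB, hB1, hB2, hpos, hneg⟩ := s.toJordanDecomposition_spec
  have hp : s.toJordanDecomposition.posPart univ ≤ ENNReal.ofReal |s B| := by
    rw [hpos, SignedMeasure.toMeasureOfZeroLE_apply _ _ _ MeasurableSet.univ]
    simp only [inter_univ]
    rw [ENNReal.ofReal, ENNReal.coe_le_coe, ← NNReal.coe_le_coe]
    simpa using le_abs_self (s B)
  have hn : s.toJordanDecomposition.negPart univ ≤ ENNReal.ofReal |s Bᶜ| := by
    rw [hneg, SignedMeasure.toMeasureOfLEZero_apply _ _ _ MeasurableSet.univ]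
    simp only [inter_univ]
    rw [ENNReal.ofReal, ENNReal.coe_le_coe, ← NNReal.coe_le_coe]
    simpa using neg_le_abs (s Bᶜ)
  have hsum : ENNReal.ofReal |s B| + ENNReal.ofReal |s Bᶜ| ≤ ∫⁻ x, ‖f x‖ₑ ∂μ := by
    by_cases hτ : Measurable τ
    · have hbound : ∀ E : Set Y, MeasurableSet E →
          ENNReal.ofReal |s E| ≤ ∫⁻ x in τ ⁻¹' E, ‖f x‖ₑ ∂μ := by
        intro E hE
        rw [hs, VectorMeasure.map_apply _ hτ hE, withDensityᵥ_apply hf (hτ hE),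
          ← Real.norm_eq_abs, ofReal_norm]
        exact enorm_integral_le_lintegral_enorm _
      refine (add_le_add (hbound B hB) (hbound Bᶜ hB.compl)).trans ?_
      rw [preimage_compl, lintegral_add_compl _ (hτ hB)]
    -- By convention the push-forward along a non-measurable map is zero.
    · rw [hs, VectorMeasure.map_not_measurable _ hτ]
      simp
  refine le_trans ?_ ((add_le_add hp hn).trans hsum)
  calc ∫⁻ y, ‖s.rnDeriv ν y‖ₑ ∂ν
      ≤ ∫⁻ y, (s.toJordanDecomposition.posPart.rnDeriv ν y +
          s.toJordanDecomposition.negPart.rnDeriv ν y) ∂ν := by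
        refine lintegral_mono fun y => ?_
        rw [SignedMeasure.rnDeriv_def]
        refine (enorm_sub_le).trans (add_le_add ?_ ?_) <;>
        · rw [Real.enorm_of_nonneg ENNReal.toReal_nonneg]
          exact ENNReal.ofReal_toReal_le
    _ = ∫⁻ y, s.toJordanDecomposition.posPart.rnDeriv ν y ∂ν +
          ∫⁻ y, s.toJordanDecomposition.negPart.rnDeriv ν y ∂ν :=
        lintegral_add_left (Measure.measurable_rnDeriv _ _) _
    _ ≤ _ := add_le_add Measure.lintegral_rnDeriv_le Measure.lintegral_rnDeriv_le

theorem integrable_frobeniusPerron (τ : I → I) (f : I → ℝ) :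
    Integrable (frobeniusPerron τ f) :=
  SignedMeasure.integrable_rnDeriv _ _

theorem lOneNorm_frobeniusPerron_le (τ : I → I) {f : I → ℝ} (hf : Integrable f) :
    lOneNorm (frobeniusPerron τ f) ≤ lOneNorm f := by
  rw [lOneNorm, lOneNorm, eLpNorm_one_eq_lintegral_enorm, eLpNorm_one_eq_lintegral_enorm]
  exact lintegral_enorm_rnDeriv_map_withDensityᵥ_le _ τ hf

end FrobeniusPerron

/-! ### Comparison of the interval with the circle. -/

section Circle

/-- The projection of the unit interval onto the circle. -/
noncomputable def toCircle (x : I) : UnitAddCircle := ((x : ℝ) : UnitAddCircle)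

/-- The representative in `(0, 1]` of a point of the circle. -/
noncomputable def circleRep (c : UnitAddCircle) : ℝ := AddCircle.equivIoc (1 : ℝ) 0 c

theorem circleRep_mem (c : UnitAddCircle) : circleRep c ∈ Ioc (0 : ℝ) 1 := by
  have h := (AddCircle.equivIoc (1 : ℝ) 0 c).2
  exact ⟨h.1, h.2.trans_eq (zero_add 1)⟩

theorem coe_circleRep (c : UnitAddCircle) : (circleRep c : UnitAddCircle) = c :=
  AddCircle.coe_equivIoc

theorem circleRep_coe {t : ℝ} (ht : t ∈ Ioc (0 : ℝ) 1) : circleRep (t : UnitAddCircle) = t :=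
  AddCircle.equivIoc_coe_of_mem (by rwa [zero_add])

theorem measurable_circleRep : Measurable circleRep :=
  measurable_subtype_coe.comp (AddCircle.measurableEquivIoc (1 : ℝ) 0).measurable

/-- The representative in the unit interval of a point of the circle. -/
noncomputable def fromCircle (c : UnitAddCircle) : I :=
  ⟨circleRep c, (circleRep_mem c).1.le, (circleRep_mem c).2⟩

theorem measurable_fromCircle : Measurable fromCircle :=
  measurable_circleRep.subtype_mk

theorem measurePreserving_toCircle : MeasurePreserving toCircle := by
  have h := UnitAddCircle.measurePreserving_mk 0
  rw [zero_add, Measure.restrict_congr_set Ioc_ae_eq_Icc] at h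
  exact h.comp unitInterval.measurePreserving_coe

/-- Only `0` is exceptional: its representative in `(0, 1]` is `1`. -/
theorem ae_fromCircle_toCircle : ∀ᵐ x : I, fromCircle (toCircle x) = x := by
  have h : ∀ᵐ x : I, x ≠ 0 := by simp [ae_iff]
  filter_upwards [h] with x hx
  refine Subtype.ext (circleRep_coe ⟨?_, x.2.2⟩)
  exact unitInterval.pos_iff_ne_zero.2 hx

theorem dist_toCircle (x y : I) :
    dist (toCircle x) (toCircle y) = |((x : ℝ) - y) - round ((x : ℝ) - y)| := by
  rw [dist_eq_norm, toCircle, toCircle, ← AddCircle.coe_sub, UnitAddCircle.norm_eq]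

theorem dist_toCircle_le (x y : I) : dist (toCircle x) (toCircle y) ≤ dist x y := by
  rw [dist_toCircle, Subtype.dist_eq, Real.dist_eq]
  simpa using round_le ((x : ℝ) - y) 0

/-- At distance at least `r` from both endpoints the circle ball does not wrap around: a nonzero
rounding integer would force `y` out of `[0, 1]`. -/
theorem mem_ball_of_toCircle_mem_ball {x y : I} {r : ℝ} (h0 : r ≤ x) (h1 : (x : ℝ) ≤ 1 - r)
    (h : toCircle y ∈ Metric.ball (toCircle x) r) : y ∈ Metric.ball x r := by
  rw [Metric.mem_ball, dist_toCircle] at h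
  rw [Metric.mem_ball, Subtype.dist_eq, Real.dist_eq]
  obtain ⟨hl, hr⟩ := abs_lt.1 h
  have hy0 := y.2.1
  have hy1 := y.2.2
  rcases lt_trichotomy (round ((y : ℝ) - x)) 0 with hn | hn | hn
  · have : ((round ((y : ℝ) - x) : ℤ) : ℝ) ≤ -1 := by exact_mod_cast Int.le_sub_one_of_lt hn
    linarith
  · rw [hn] at h
    simpa using h
  · have : (1 : ℝ) ≤ ((round ((y : ℝ) - x) : ℤ) : ℝ) := by exact_mod_cast hn
    linarith

theorem volume_boundaryLayer_le (r : ℝ) :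
    volume {x : I | (x : ℝ) < r ∨ 1 - r < (x : ℝ)} ≤ ENNReal.ofReal r + ENNReal.ofReal r := by
  rw [unitInterval.volume_apply]
  have hsub : Subtype.val '' {x : I | (x : ℝ) < r ∨ 1 - r < (x : ℝ)} ⊆
      Ico (0 : ℝ) r ∪ Ioc (1 - r) 1 := by
    rintro _ ⟨x, hx | hx, rfl⟩
    · exact Or.inl ⟨x.2.1, hx⟩
    · exact Or.inr ⟨hx, x.2.2⟩
  refine (measure_mono hsub).trans ((measure_union_le _ _).trans ?_)
  simp

/-- Going over to the circle costs only the total oscillation on a boundary layer. -/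
theorem lintegral_essOsc_circle_le {g : I → ℝ} (hg : Measurable g) {D : ℝ≥0∞}
    (hD : ∀ᵐ y : I × I, ‖g y.1 - g y.2‖ₑ ≤ D) (r : ℝ) :
    ∫⁻ c, essOsc (g ∘ fromCircle) r c ≤
      oscOne g r + D * (ENNReal.ofReal r + ENNReal.ofReal r) := by
  have hG : Measurable (g ∘ fromCircle) := hg.comp measurable_fromCircle
  have hπ := measurePreserving_toCircle
  set S : Set I := {x : I | (x : ℝ) < r ∨ 1 - r < (x : ℝ)} with hS
  have hSm : MeasurableSet S :=
    (measurableSet_lt measurable_subtype_coe measurable_const).union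
      (measurableSet_lt measurable_const measurable_subtype_coe)
  have hpt : ∀ x : I, essOsc (g ∘ fromCircle) r (toCircle x) ≤
      essOsc g r x + S.indicator (fun _ => D) x := by
    intro x
    have hm : MeasurableSet {z : UnitAddCircle × UnitAddCircle |
        z.1 ∈ Metric.ball (toCircle x) r → z.2 ∈ Metric.ball (toCircle x) r →
          ‖(g ∘ fromCircle) z.1 - (g ∘ fromCircle) z.2‖ₑ ≤
            essOsc g r x + S.indicator (fun _ => D) x} := by
      have hb1 : MeasurableSet {z : UnitAddCircle × UnitAddCircle |
          z.1 ∈ Metric.ball (toCircle x) r} := measurableSet_ball.preimage measurable_fst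
      have hb2 : MeasurableSet {z : UnitAddCircle × UnitAddCircle |
          z.2 ∈ Metric.ball (toCircle x) r} := measurableSet_ball.preimage measurable_snd
      refine hb1.imp (hb2.imp (measurableSet_le ?_ measurable_const))
      exact ((hG.comp measurable_fst).sub (hG.comp measurable_snd)).enorm
    have hππ := hπ.prod hπ
    rw [essOsc_le_iff, Measure.volume_eq_prod, ← hππ.map_eq, ae_map_iff hππ.aemeasurable hm]
    have e1 : ∀ᵐ y : I × I, fromCircle (toCircle y.1) = y.1 :=
      Measure.quasiMeasurePreserving_fst.ae ae_fromCircle_toCircle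
    have e2 : ∀ᵐ y : I × I, fromCircle (toCircle y.2) = y.2 :=
      Measure.quasiMeasurePreserving_snd.ae ae_fromCircle_toCircle
    filter_upwards [e1, e2, hD, ae_le_essOsc g r x] with y hy1 hy2 hyD hy hb1 hb2
    simp only [Prod.map_fst, Prod.map_snd, Function.comp_apply, hy1, hy2] at hb1 hb2 ⊢
    -- In the layer only the global bound `D` is available; outside it the circle ball lifts to the
    -- ball in `I`.
    by_cases hx : x ∈ S
    · rw [indicator_of_mem hx]
      exact hyD.trans le_add_self
    · simp only [hS, mem_ofPred_eq, not_or, not_lt] at hx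
      exact (hy (mem_ball_of_toCircle_mem_ball hx.1 hx.2 hb1)
        (mem_ball_of_toCircle_mem_ball hx.1 hx.2 hb2)).trans le_self_add
  calc ∫⁻ c, essOsc (g ∘ fromCircle) r c
      = ∫⁻ x : I, essOsc (g ∘ fromCircle) r (toCircle x) :=
        (hπ.lintegral_comp (measurable_essOsc hG r)).symm
    _ ≤ ∫⁻ x : I, (essOsc g r x + S.indicator (fun _ => D) x) := lintegral_mono hpt
    _ = oscOne g r + D * volume S := by
        rw [lintegral_add_left (measurable_essOsc hg r), lintegral_indicator_const hSm]
        rfl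
    _ ≤ _ := by gcongr; exact volume_boundaryLayer_le r

end Circle

/-! ### The noise kernel as a convolution kernel on the circle. -/

section Noise

/-- The noise kernel at scale `δ`, as a function on the circle. -/
noncomputable def circleKernel (q : ℝ → ℝ) (δ : ℝ) (c : UnitAddCircle) : ℝ :=
  δ⁻¹ * q (circleRep c / δ) + δ⁻¹ * q ((circleRep c - 1) / δ)

variable {q : ℝ → ℝ} {δ : ℝ}

theorem IsNoiseKernel.eq_zero (hq : IsNoiseKernel q) {z : ℝ} (hz : 1 < |z|) : q z = 0 := by
  refine image_eq_zero_of_notMem_tsupport fun h => ?_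
  have := abs_le.2 (hq.tsupport_subset h)
  linarith

theorem IsNoiseKernel.hasCompactSupport (hq : IsNoiseKernel q) : HasCompactSupport q :=
  HasCompactSupport.of_support_subset_isCompact isCompact_Icc
    ((subset_tsupport q).trans hq.tsupport_subset)

theorem IsNoiseKernel.continuous (hq : IsNoiseKernel q) : Continuous q := hq.contDiff.continuous

theorem IsNoiseKernel.tsum_eq (hq : IsNoiseKernel q) (h0 : 0 < δ) (h1 : δ < 1) {t : ℝ}
    (ht : t ∈ Icc (0 : ℝ) 1) :
    ∑' n : ℤ, δ⁻¹ * q ((t + n) / δ) = δ⁻¹ * q (t / δ) + δ⁻¹ * q ((t - 1) / δ) := by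
  -- For `t ∈ [0, 1]` and `δ < 1` every other shift satisfies `|t + n| ≥ 1 > δ`, outside the
  -- support.
  rw [tsum_eq_sum (s := {0, -1})]
  · rw [Finset.sum_pair (by norm_num)]
    simp [sub_eq_add_neg]
  · intro n hn
    simp only [Finset.mem_insert, Finset.mem_singleton, not_or] at hn
    rw [hq.eq_zero, mul_zero]
    rw [abs_div, abs_of_pos h0, lt_div_iff₀ h0, one_mul]
    refine h1.trans_le ?_
    rcases lt_or_ge n 0 with h | h
    · have : (n : ℝ) ≤ -2 := by exact_mod_cast (by omega : n ≤ -2)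
      rw [abs_of_neg (by linarith [ht.2])]
      linarith [ht.2]
    · have : (1 : ℝ) ≤ n := by exact_mod_cast (by omega : 1 ≤ n)
      exact (by linarith [ht.1] : 1 ≤ t + n).trans (le_abs_self _)

/-- The sum over `ℤ` is invariant under integer shifts, so `x - y` may be replaced by its
representative in `(0, 1]`. -/
theorem IsNoiseKernel.periodizedKernel_eq (hq : IsNoiseKernel q) (h0 : 0 < δ) (h1 : δ < 1)
    (x y : I) : periodizedKernel q δ x y = circleKernel q δ (toCircle x - toCircle y) := by
  obtain ⟨m, hm⟩ : ∃ m : ℤ, circleRep (toCircle x - toCircle y) = (x : ℝ) - y + m := by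
    have h : ((circleRep (toCircle x - toCircle y) - ((x : ℝ) - y) : ℝ) : UnitAddCircle) = 0 := by
      rw [AddCircle.coe_sub, coe_circleRep, AddCircle.coe_sub, toCircle, toCircle, sub_self]
    obtain ⟨m, hm⟩ := (AddCircle.coe_eq_zero_iff 1).1 h
    exact ⟨m, by rw [zsmul_one] at hm; linarith⟩
  rw [circleKernel, ← hq.tsum_eq h0 h1 (Ioc_subset_Icc_self (circleRep_mem _)), hm,
    periodizedKernel, ← (Equiv.addLeft m).tsum_eq]
  simp [add_assoc]

theorem measurable_circleKernel (hq : IsNoiseKernel q) : Measurable (circleKernel q δ) := by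
  have h := hq.continuous.measurable
  have h' := measurable_circleRep
  unfold circleKernel
  fun_prop

theorem IsNoiseKernel.circleKernel_bounded (hq : IsNoiseKernel q) (δ : ℝ) :
    ∃ c, ∀ a, ‖circleKernel q δ a‖ ≤ c := by
  obtain ⟨C, hC⟩ := hq.hasCompactSupport.exists_bound_of_continuous hq.continuous
  refine ⟨‖δ⁻¹‖ * C + ‖δ⁻¹‖ * C, fun a => (norm_add_le _ _).trans ?_⟩
  rw [norm_mul, norm_mul]
  gcongr <;> exact hC _

/-- The two summands are the rescaled density on `(0, 1]` and, after a unit shift, on `(-1, 0]`;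
these intervals are disjoint and the density has mass one. -/
theorem IsNoiseKernel.lintegral_circleKernel_le (hq : IsNoiseKernel q) (h0 : 0 < δ) :
    ∫⁻ c, ‖circleKernel q δ c‖ₑ ≤ 1 := by
  have hqm := hq.continuous.measurable
  set φ : ℝ → ℝ := fun t => δ⁻¹ * q (t / δ) with hφ
  have hφm : Measurable φ := by fun_prop
  have hφi : Integrable φ :=
    ((hq.continuous.integrable_of_hasCompactSupport hq.hasCompactSupport).comp_div h0.ne').const_mul _
  have htot : ∫⁻ t, ‖φ t‖ₑ = 1 := by
    have hnn : ∀ t, 0 ≤ φ t := fun t => mul_nonneg (inv_nonneg.2 h0.le) (hq.nonneg _)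
    rw [← ofReal_integral_norm_eq_lintegral_enorm hφi]
    simp_rw [fun t => Real.norm_of_nonneg (hnn t)]
    rw [hφ, integral_const_mul, Measure.integral_comp_div, hq.integral_eq_one, abs_of_pos h0]
    simp [h0.ne']
  have hshift : ∫⁻ t in Ioc (0 : ℝ) 1, ‖φ (t - 1)‖ₑ = ∫⁻ t in Ioc (-1 : ℝ) 0, ‖φ t‖ₑ := by
    have hp := measurePreserving_sub_right (volume : Measure ℝ) 1
    have := hp.setLIntegral_comp_preimage (s := Ioc (-1 : ℝ) 0) measurableSet_Ioc hφm.enorm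
    rw [← this]
    congr 2
    ext t
    simp
  calc ∫⁻ c, ‖circleKernel q δ c‖ₑ
      = ∫⁻ t in Ioc (0 : ℝ) 1, ‖circleKernel q δ (t : UnitAddCircle)‖ₑ := by
        rw [← UnitAddCircle.lintegral_preimage 0, zero_add]
    _ = ∫⁻ t in Ioc (0 : ℝ) 1, ‖φ t + φ (t - 1)‖ₑ :=
        setLIntegral_congr_fun measurableSet_Ioc fun t ht => by
          simp only [circleKernel, circleRep_coe ht, hφ]
    _ ≤ ∫⁻ t in Ioc (0 : ℝ) 1, (‖φ t‖ₑ + ‖φ (t - 1)‖ₑ) :=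
        lintegral_mono fun t => enorm_add_le _ _
    _ = (∫⁻ t in Ioc (0 : ℝ) 1, ‖φ t‖ₑ) + ∫⁻ t in Ioc (-1 : ℝ) 0, ‖φ t‖ₑ := by
        rw [lintegral_add_left hφm.enorm, hshift]
    _ = ∫⁻ t in Ioc (0 : ℝ) 1 ∪ Ioc (-1 : ℝ) 0, ‖φ t‖ₑ := by
        rw [lintegral_union measurableSet_Ioc]
        exact disjoint_left.2 fun t (h : t ∈ Ioc 0 1) (h' : t ∈ Ioc (-1) 0) => h'.2.not_gt h.1
    _ ≤ ∫⁻ t, ‖φ t‖ₑ := setLIntegral_le_lintegral _ _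
    _ = 1 := htot

theorem IsNoiseKernel.smoothing_eq (hq : IsNoiseKernel q) (h0 : 0 < δ) (h1 : δ < 1) {g : I → ℝ}
    {G : UnitAddCircle → ℝ} (hG : Measurable G) (hGg : G ∘ toCircle =ᵐ[volume] g) :
    smoothing q δ g =
      (fun u => ∫ c, circleKernel q δ c * G (u - c)) ∘ toCircle := by
  ext x
  have hKm := measurable_circleKernel (δ := δ) hq
  have hm : Measurable fun c => circleKernel q δ (toCircle x - c) * G c := by fun_prop
  calc smoothing q δ g x
      = ∫ y : I, circleKernel q δ (toCircle x - toCircle y) * G (toCircle y) := by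
        refine integral_congr_ae ?_
        filter_upwards [hGg] with y hy
        rw [hq.periodizedKernel_eq h0 h1, ← hy, Function.comp_apply]
    _ = ∫ c, circleKernel q δ (toCircle x - c) * G c := by
        rw [← measurePreserving_toCircle.map_eq,
          integral_map measurePreserving_toCircle.aemeasurable hm.aestronglyMeasurable]
    _ = _ := by
        rw [← integral_sub_left_eq_self _ volume (toCircle x)]
        simp

/-- Balls are open, so a unit ball centred at one endpoint misses the other. This makes the scale `r
= 1` control the global oscillation. -/
theorem volume_compl_ball_one (x : I) : volume (Metric.ball x 1)ᶜ = 0 := by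
  have hsub : (Metric.ball x 1)ᶜ ⊆ ({0, 1} : Set I) := by
    intro y hy
    rw [mem_compl_iff, Metric.mem_ball, Subtype.dist_eq, Real.dist_eq, not_lt, le_abs] at hy
    have := x.2.1
    have := x.2.2
    have := y.2.1
    have := y.2.2
    rcases hy with hy | hy
    · exact Or.inr (Subtype.ext (by simp only [Set.Icc.coe_one]; linarith))
    · exact Or.inl (Subtype.ext (by simp only [Set.Icc.coe_zero]; linarith))
  exact measure_mono_null hsub ((Set.toFinite _).measure_zero _)

variable {p : ℝ}

theorem oscOne_le_bvVar_mul (f : I → ℝ) {r : ℝ} (hr : r ∈ Ioc (0 : ℝ) 1) :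
    oscOne f r ≤ bvVar p f * ENNReal.ofReal (r ^ (1 / p)) := by
  have hpos : 0 < r ^ (1 / p) := Real.rpow_pos_of_pos hr.1 _
  rw [← ENNReal.div_le_iff (by simpa using hpos) ENNReal.ofReal_ne_top]
  exact le_iSup₂ (f := fun r _ => oscOne f r / ENNReal.ofReal (r ^ (1 / p))) r hr

/-- The 3 is one for the interior oscillation and one for each of the two boundary layers of width
`r`. -/
theorem IsNoiseKernel.smoothing_bounds (hq : IsNoiseKernel q) (h0 : 0 < δ) (h1 : δ < 1)
    (hp : 1 ≤ p) {g : I → ℝ} (hg : Integrable g) :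
    Integrable (smoothing q δ g) ∧ lOneNorm (smoothing q δ g) ≤ lOneNorm g ∧
      bvVar p (smoothing q δ g) ≤ 3 * bvVar p g := by
  have hπ := measurePreserving_toCircle
  obtain ⟨g', hg'm, hgg'⟩ := hg.aemeasurable
  set G := g' ∘ fromCircle with hGdef
  have hG : Measurable G := hg'm.comp measurable_fromCircle
  have hGg : G ∘ toCircle =ᵐ[volume] g := by
    filter_upwards [ae_fromCircle_toCircle, hgg'] with x hx hx'
    rw [Function.comp_apply, hGdef, Function.comp_apply, hx, hx']
  have hGnorm : ∫⁻ c, ‖G c‖ₑ = ∫⁻ x, ‖g x‖ₑ := by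
    rw [← hπ.lintegral_comp hG.enorm]
    refine lintegral_congr_ae ?_
    filter_upwards [hGg] with x hx
    rw [← hx, Function.comp_apply]
  have hGi : Integrable G :=
    ⟨hG.aestronglyMeasurable, by rw [HasFiniteIntegral, hGnorm]; exact hg.2⟩
  have hK := measurable_circleKernel (δ := δ) hq
  have hK1 := hq.lintegral_circleKernel_le h0
  obtain ⟨c, hKc⟩ := hq.circleKernel_bounded δ
  have heq := hq.smoothing_eq h0 h1 hG hGg
  set H : UnitAddCircle → ℝ := fun u => ∫ c, circleKernel q δ c * G (u - c) with hH
  have hHm : Measurable H := measurable_convolution hK hG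
  have hL1 : ∫⁻ x, ‖smoothing q δ g x‖ₑ ≤ ∫⁻ x, ‖g x‖ₑ := by
    rw [heq]
    calc ∫⁻ x, ‖(H ∘ toCircle) x‖ₑ = ∫⁻ u, ‖H u‖ₑ := hπ.lintegral_comp hHm.enorm
      _ ≤ (∫⁻ a, ‖circleKernel q δ a‖ₑ) * ∫⁻ u, ‖G u‖ₑ := lintegral_enorm_convolution_le hK hG
      _ ≤ 1 * ∫⁻ u, ‖G u‖ₑ := by gcongr
      _ = ∫⁻ x, ‖g x‖ₑ := by rw [one_mul, hGnorm]
  refine ⟨⟨?_, hL1.trans_lt hg.2⟩, ?_, ?_⟩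
  · rw [heq]
    exact (hHm.comp hπ.measurable).aestronglyMeasurable
  · rw [lOneNorm, lOneNorm, eLpNorm_one_eq_lintegral_enorm, eLpNorm_one_eq_lintegral_enorm]
    exact hL1
  refine iSup₂_le fun r hr => ?_
  -- Absorbs the boundary term, linear in `r`, into the scale of the variation.
  have hrp : r ≤ r ^ (1 / p) := by
    conv_lhs => rw [← Real.rpow_one r]
    exact Real.rpow_le_rpow_of_exponent_ge hr.1 hr.2 ((div_le_one (by linarith)).2 hp)
  have hosc : ∀ r, oscOne g' r = oscOne g r := fun r => by
    change ∫⁻ x, essOsc g' r x = ∫⁻ x, essOsc g r x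
    rw [essOsc_congr_ae hgg']
  have hD : ∀ᵐ y : I × I, ‖g' y.1 - g' y.2‖ₑ ≤ bvVar p g := by
    filter_upwards [enorm_sub_le_lintegral_essOsc volume_compl_ball_one g'] with y hy
    refine hy.trans ((hosc 1).trans_le ?_)
    simpa using oscOne_le_bvVar_mul (p := p) g (r := 1) (by simp)
  refine ENNReal.div_le_of_le_mul ?_
  calc oscOne (smoothing q δ g) r
      ≤ ∫⁻ x : I, essOsc H r (toCircle x) := by
        rw [heq]
        exact lintegral_mono fun x => essOsc_comp_le hπ dist_toCircle_le H r x
    _ = ∫⁻ u, essOsc H r u := hπ.lintegral_comp (measurable_essOsc hHm r)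
    _ ≤ (∫⁻ a, ‖circleKernel q δ a‖ₑ) * ∫⁻ u, essOsc G r u :=
        lintegral_essOsc_convolution_le hK hKc hG hGi r
    _ ≤ 1 * ∫⁻ u, essOsc G r u := by gcongr
    _ ≤ oscOne g r + bvVar p g * (ENNReal.ofReal r + ENNReal.ofReal r) := by
        rw [one_mul, ← hosc]
        exact lintegral_essOsc_circle_le hg'm hD r
    _ ≤ bvVar p g * ENNReal.ofReal (r ^ (1 / p)) +
          bvVar p g * (ENNReal.ofReal (r ^ (1 / p)) + ENNReal.ofReal (r ^ (1 / p))) := by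
        gcongr
        exact oscOne_le_bvVar_mul g hr
    _ = 3 * bvVar p g * ENNReal.ofReal (r ^ (1 / p)) := by ring

end Noise

/-! ### The uniform Lasota–Yorke inequality. -/

theorem three_le_kernelConstant (q : ℝ → ℝ) {p : ℝ} (hp : 1 ≤ p) : 3 ≤ kernelConstant q p := by
  have h1 : 1 ≤ (2 : ℝ) ^ (1 / p) :=
    Real.one_le_rpow (by norm_num) (by positivity)
  have h2 : (2 : ℝ) ^ (1 + 1 / p) = 2 * 2 ^ (1 / p) := by
    rw [Real.rpow_add (by norm_num), Real.rpow_one]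
  have h3 := le_max_left 1 (4 * derivSupNorm q)
  rw [kernelConstant, h2]
  have h4 : 3 ≤ (1 + 2 * (2 : ℝ) ^ (1 / p)) * 2 ^ (1 / p) := by nlinarith
  nlinarith

theorem mainTheorem1 (s ε p : ℝ) (hp : 1 ≤ p)
    (τ : unitInterval → unitInterval) (hτ : IsPiecewiseExpanding s ε τ)
    (q : ℝ → ℝ) (hq : IsNoiseKernel q)
    (hjoint : lasotaYorkeConstant τ p < ENNReal.ofReal (1 / kernelConstant q p)) :
    ∃ α C : ℝ, 0 < α ∧ α < 1 ∧ 0 < C ∧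
      ∀ δ : ℝ, 0 < δ → δ < 1 / 4 →
        ∀ f : unitInterval → ℝ, MemBV p f →
          MemBV p (perturbedFP τ q δ f) ∧
          bvNorm p (perturbedFP τ q δ f) ≤
            ENNReal.ofReal α * bvNorm p f + ENNReal.ofReal C * lOneNorm f := by
  -- The strict inequality for the infimum yields an actual admissible pair below the threshold.
  obtain ⟨_, ⟨a, C₀, ⟨ha0, -, hC₀, hLY⟩, rfl⟩, ha⟩ := sInf_lt_iff.1 hjoint
  have hK := three_le_kernelConstant q hp
  have haK : 3 * a < 1 := by
    have h := (ENNReal.ofReal_lt_ofReal_iff (by positivity)).1 ha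
    rw [lt_div_iff₀ (by linarith)] at h
    nlinarith
  -- The factors 3 come from the variation of the smoothing, the `+ 1` from the `L¹` part of the
  -- norm.
  refine ⟨3 * a, 3 * C₀ + 1, by positivity, haK, by positivity, fun δ h0 h1 f hf => ?_⟩
  obtain ⟨hint, hL1, hvar⟩ := hq.smoothing_bounds h0 (by linarith) hp
    (integrable_frobeniusPerron τ f)
  have hLYf := hLY f hf
  have hfL : lOneNorm f < ∞ := (memLp_one_iff_integrable.2 hf.1).2
  have hvar' := hvar.trans (mul_le_mul_right hLYf 3)
  refine ⟨⟨hint, hvar'.trans_lt ?_⟩, ?_⟩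
  · have hfn : bvNorm p f < ∞ := ENNReal.add_lt_top.2 ⟨hf.2, hfL⟩
    finiteness
  · calc bvNorm p (perturbedFP τ q δ f)
        ≤ 3 * (ENNReal.ofReal a * bvNorm p f + ENNReal.ofReal C₀ * lOneNorm f) + lOneNorm f :=
          add_le_add hvar' (hL1.trans (lOneNorm_frobeniusPerron_le τ hf.1))
      _ = ENNReal.ofReal (3 * a) * bvNorm p f + ENNReal.ofReal (3 * C₀ + 1) * lOneNorm f := by
          rw [ENNReal.ofReal_add (by positivity) (by norm_num), ENNReal.ofReal_mul (by norm_num),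
            ENNReal.ofReal_mul (by norm_num), ENNReal.ofReal_ofNat, ENNReal.ofReal_one]
          ring
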